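/- Let $G$ be a finite group, $g\in G$ an element of order $\mathrm o(g)$, and $N$ a natural number. Let $C^{2N}_G$ be the set of $2N$-conjugacy classes, i.e. of orbits of $G$ acting by simultaneous conjugation on $N$-tuples $((h_1|y_1),\dots,(h_N|y_N))$ of pairs of elements of $G$. Let $\mathrm{Map}_{N,1}$ be the mapping class group of the genus-$N$ surface with one boundary circle, realized as the group of those automorphisms of the free group $F_{2N}$ on $a_1,b_1,\dots,a_N,b_N$ that fix the boundary word $\prod_{i=1}^N [a_i,b_i]$, where $[x,y]=x^{-1}y^{-1}xy$, and let $\mathrm{Map}_N$ be the mapping class group of the closed oriented surface $\Sigma_N$ of genus $N$, i.e. the image of $\mathrm{Map}_{N,1}$ in the group of outer automorphisms of $\pi_1(\Sigma_N)=F_{2N}/\langle\langle \prod_i [a_i,b_i]\rangle\rangle$. Identify a tuple $((h_i|y_i))_i$ with the homomorphism $\rho\colon F_{2N}\to G$, $a_i\mapsto h_i$, $b_i\mapsto y_i$. Then $\mathrm{Map}_{N,1}$ acts on $C^{2N}_G$ by $\varphi\cdot[\rho]=[\rho\circ\varphi^{-1}]$, and on the classes of tuples with $\prod_i[h_i,y_i]=e$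 this action descends to an action of $\mathrm{Map}_N$. For $v=(m_1,\dots,m_N,n_1,\dots,n_N)\in\mathbb Z^{2N}$ let $[g^v]\in C^{2N}_G$ be the class of $((g^{m_1}|g^{n_1}),\dots,(g^{m_N}|g^{n_N}))$ and put $\gamma(v)=\gcd(m_1,\dots,m_N,n_1,\dots,n_N,\mathrm o(g))$. (i) For all $v,w\in\mathbb Z^{2N}$ with $\gamma(v)=\gamma(w)$, the class $[g^w]$ lies in the $\mathrm{Map}_N$-orbit of $[g^v]$. Moreover, the $\mathrm{Map}_N$-action on the set $X_g=\{[g^v] : v\in\mathbb Z^{2N}\}$ factors through an action of $\mathrm{Sp}(2N,\mathbb Z)$: the action of $\mathrm{Map}_N$ on $H^1(\Sigma_N;\mathbb Z)=\mathrm{Hom}(\pi_1(\Sigma_N),\mathbb Z)\cong\mathbb Z^{2N}$, $\varphi\cdot f=f\circ\varphi^{-1}$ (equivalently, by Poincaré duality, on $H_1(\Sigma_N;\mathbb Z)$), is given by a homomorphism $s\colon\mathrm{Map}_N\to\mathrm{Sp}(2N,\mathbb Z)$, the formula $A\cdot[g^v]=[g^{Av}]$ defines an action of $\mathrm{Sp}(2N,\mathbb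 Z)$ on $X_g$, and $\varphi\cdot d=s(\varphi)\cdot d$ for all $\varphi\in\mathrm{Map}_N$ and $d\in X_g$. (ii) Suppose that any two different elements of the cyclic subgroup $\langle g\rangle$ belong to distinct conjugacy classes of $G$. Then $[g^v]$ and $[g^w]$ lie in the same $\mathrm{Map}_N$-orbit if and only if $\gamma(v)=\gamma(w)$. Moreover, $v\mapsto[g^v]$ induces an injective map $P\colon(\mathbb Z/\mathrm o(g)\mathbb Z)^{2N}\to C^{2N}_G$, and for every $z$ the $\mathrm{Map}_N$-orbit of $P(z)$ is the image under $P$ of the orbit of $z$ under the defining action of $\mathrm{Sp}(2N,\mathbb Z/\mathrm o(g)\mathbb Z)$ on $(\mathbb Z/\mathrm o(g)\mathbb Z)^{2N}$. -/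

import Mathlib

/-! ## Tuples `((h₁|y₁),…,(h_N|y_N))` and `2N`-conjugacy classes -/

namespace MCG

/-- `G^{×2N}`: `N`-tuples of pairs `(h|y)` of elements of `G`. -/
abbrev Tuple (N : ℕ) (G : Type*) : Type _ := Fin N → G × G

/-- The group commutator `[h,y] = h⁻¹ y⁻¹ h y` of a pair. -/
def pairComm {G : Type*} [Group G] (p : G × G) : G := p.1⁻¹ * p.2⁻¹ * p.1 * p.2

/-- The multi-commutator `[h₁,y₁] [h₂,y₂] ⋯ [h_N,y_N]`. -/
def multiComm {N : ℕ} {G : Type*} [Group G] (t : Tuple N G) : G :=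
  (List.ofFn fun i => pairComm (t i)).prod

/-- Apply a homomorphism to all entries of a tuple. -/
def mapTuple {N : ℕ} {G H : Type*} [Group G] [Group H] (f : G →* H) (t : Tuple N G) :
    Tuple N H := fun i => (f (t i).1, f (t i).2)

theorem multiComm_map {N : ℕ} {G H : Type*} [Group G] [Group H] (f : G →* H) (t : Tuple N G) :
    multiComm (mapTuple f t) = f (multiComm t) := by
  simp [multiComm, mapTuple, pairComm, map_list_prod, List.map_ofFn, Function.comp_def]

/-- Simultaneous conjugation of all entries, as the action of `ConjAct G` on tuples. -/
theorem smul_eq_mapTuple {N : ℕ} {G : Type*} [Group G] (c : ConjAct G) (t : Tuple N G) :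
    c • t = mapTuple (MulAut.conj (ConjAct.ofConjAct c)).toMonoidHom t := by
  funext i
  simp [mapTuple, ConjAct.smul_def, Prod.ext_iff]

/-- `C^{2N}_G`, the set of `2N`-conjugacy classes: orbits of simultaneous conjugation
on `G^{×2N}`. -/
abbrev TupleClass (N : ℕ) (G : Type*) [Group G] : Type _ :=
  MulAction.orbitRel.Quotient (ConjAct G) (Tuple N G)

/-- The `2N`-conjugacy class of a tuple. -/
def classOf {N : ℕ} {G : Type*} [Group G] (t : Tuple N G) : TupleClass N G := Quotient.mk _ t

theorem classOf_eq_iff {N : ℕ} {G : Type*} [Group G] {t u : Tuple N G} :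
    classOf t = classOf u ↔ ∃ c : ConjAct G, c • u = t := by
  unfold classOf
  rw [Quotient.eq]
  exact MulAction.orbitRel_apply

/-- The map `μ_N : C^{2N}_G → C_G` induced by the multi-commutator. -/
def multiCommClass {N : ℕ} {G : Type*} [Group G] : TupleClass N G → ConjClasses G :=
  Quotient.lift (fun t => ConjClasses.mk (multiComm t)) (by
    intro a b hab
    obtain ⟨c, rfl⟩ := hab
    dsimp only
    rw [ConjClasses.mk_eq_mk_iff_isConj, smul_eq_mapTuple, multiComm_map]
    exact (isConj_iff.2 ⟨ConjAct.ofConjAct c, rfl⟩ : IsConj (multiComm b) _).symm)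

/-- The subset `μ_N⁻¹(c_e)` of `C^{2N}_G`: classes of tuples with trivial multi-commutator. -/
abbrev FlatClass (N : ℕ) (G : Type*) [Group G] : Type _ :=
  {d : TupleClass N G // multiCommClass d = ConjClasses.mk 1}

/-! ## The mapping class groups -/

/-- The free group of rank `2N`: the fundamental group of the genus-`N` surface with one
boundary circle (based on the boundary). -/
abbrev FreeSurf (N : ℕ) : Type := FreeGroup (Fin N ⊕ Fin N)

/-- The tuple of free generators. -/
def genTuple (N : ℕ) : Tuple N (FreeSurf N) :=
  fun i => (FreeGroup.of (Sum.inl i), FreeGroup.of (Sum.inr i))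

/-- The homotopy class of the boundary circle. -/
def boundaryWord (N : ℕ) : FreeSurf N := multiComm (genTuple N)

/-- `Map_{N,1}`, the mapping class group of the genus-`N` surface with one boundary circle
(homeomorphisms and isotopies fixing the boundary pointwise), in its description by
Dehn–Nielsen–Baer: the automorphisms of the fundamental group that fix the class of the
boundary circle. -/
def MapBdry (N : ℕ) : Subgroup (MulAut (FreeSurf N)) :=
  MulAction.stabilizer (MulAut (FreeSurf N)) (boundaryWord N)

/-- The fundamental group of the closed surface of genus `N`. -/
abbrev SurfaceGroup (N : ℕ) : Type := PresentedGroup ({boundaryWord N} : Set (FreeSurf N))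

theorem mapBdry_boundary {N : ℕ} (φ : MapBdry N) : φ.1 (boundaryWord N) = boundaryWord N := φ.2

/-- A mapping class of the surface with boundary acts on the closed surface group. -/
def inducedHom {N : ℕ} (φ : MapBdry N) : SurfaceGroup N →* SurfaceGroup N :=
  PresentedGroup.toGroup
    (f := fun k => PresentedGroup.mk {boundaryWord N} (φ.1 (FreeGroup.of k))) (by
      rintro r rfl
      have h : FreeGroup.lift (fun k => PresentedGroup.mk {boundaryWord N} (φ.1 (FreeGroup.of k)))
          = (PresentedGroup.mk {boundaryWord N}).comp φ.1.toMonoidHom := by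
        ext k; simp
      rw [h]
      have h2 := mapBdry_boundary φ
      simp only [MonoidHom.comp_apply, MulEquiv.toMonoidHom_eq_coe, MonoidHom.coe_coe, h2]
      exact PresentedGroup.one_of_mem (Set.mem_singleton _))

theorem inducedHom_mk {N : ℕ} (φ : MapBdry N) (x : FreeSurf N) :
    inducedHom φ (PresentedGroup.mk {boundaryWord N} x) =
      PresentedGroup.mk {boundaryWord N} (φ.1 x) := by
  have h : (inducedHom φ).comp (PresentedGroup.mk {boundaryWord N})
      = (PresentedGroup.mk {boundaryWord N}).comp φ.1.toMonoidHom := by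
    ext k
    simp only [MonoidHom.comp_apply]
    exact PresentedGroup.toGroup.of _
  exact DFunLike.congr_fun h x

/-- The kernel of `Map_{N,1} → Out(π₁ of the closed surface)`: those mapping classes which
become inner after the boundary circle is capped by a disk. -/
def capKernel (N : ℕ) : Subgroup (MapBdry N) where
  carrier := {φ | ∃ c : SurfaceGroup N, ∀ x : FreeSurf N,
    PresentedGroup.mk {boundaryWord N} (φ.1 x) =
      c * PresentedGroup.mk {boundaryWord N} x * c⁻¹}
  one_mem' := ⟨1, fun x => by simp⟩
  mul_mem' := by
    rintro φ ψ ⟨c, hc⟩ ⟨d, hd⟩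
    refine ⟨c * d, fun x => ?_⟩
    have : (φ * ψ).1 x = φ.1 (ψ.1 x) := rfl
    rw [this, hc, hd]
    group
  inv_mem' := by
    rintro φ ⟨c, hc⟩
    refine ⟨c⁻¹, fun x => ?_⟩
    have h := hc ((φ⁻¹).1 x)
    have h2 : φ.1 ((φ⁻¹).1 x) = x := MulAut.apply_inv_self _ φ.1 x
    rw [h2] at h
    rw [h]
    group

instance capKernel_normal (N : ℕ) : (capKernel N).Normal := by
  refine ⟨?_⟩
  rintro φ ⟨c, hc⟩ ψ
  refine ⟨inducedHom ψ c, fun x => ?_⟩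
  have h : (ψ * φ * ψ⁻¹).1 x = ψ.1 (φ.1 ((ψ⁻¹).1 x)) := rfl
  have h2 : ψ.1 ((ψ⁻¹).1 x) = x := MulAut.apply_inv_self _ ψ.1 x
  rw [h, ← inducedHom_mk, hc, map_mul, map_mul, inducedHom_mk, h2, map_inv]

/-- `Map_N = Map_{N,0}`, the mapping class group of the closed oriented surface of genus `N`:
the quotient of `Map_{N,1}` obtained by capping the hole, equivalently the group of outer
automorphisms of the closed surface group which are induced by `Map_{N,1}`. -/
abbrev MapClosed (N : ℕ) : Type := MapBdry N ⧸ capKernel N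

/-! ## The action on `2N`-conjugacy classes -/

/-- A tuple is the same thing as a homomorphism from the free group of rank `2N`. -/
def tupleHom {N : ℕ} {G : Type*} [Group G] (t : Tuple N G) : FreeSurf N →* G :=
  FreeGroup.lift (Sum.elim (fun i => (t i).1) (fun i => (t i).2))

theorem mapTuple_tupleHom_gen {N : ℕ} {G : Type*} [Group G] (t : Tuple N G) :
    mapTuple (tupleHom t) (genTuple N) = t := by
  funext i
  simp [mapTuple, tupleHom, genTuple]

theorem tupleHom_mapTuple {N : ℕ} {G H : Type*} [Group G] [Group H] (f : G →* H)
    (t : Tuple N G) : tupleHom (mapTuple f t) = f.comp (tupleHom t) := by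
  ext k
  rcases k with k | k <;> simp [mapTuple, tupleHom]

theorem tupleHom_gen (N : ℕ) : tupleHom (genTuple N) = MonoidHom.id (FreeSurf N) := by
  ext k
  rcases k with k | k <;> simp [genTuple, tupleHom]

theorem mapTuple_comp {N : ℕ} {G H K : Type*} [Group G] [Group H] [Group K] (f : G →* H)
    (f' : H →* K) (t : Tuple N G) : mapTuple f' (mapTuple f t) = mapTuple (f'.comp f) t := rfl

theorem multiComm_eq {N : ℕ} {G : Type*} [Group G] (t : Tuple N G) :
    multiComm t = tupleHom t (boundaryWord N) := by
  rw [boundaryWord, ← multiComm_map, mapTuple_tupleHom_gen]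

/-- The tuple that corresponds to the homomorphism `ρ ∘ φ⁻¹`, where `ρ` is the homomorphism
that corresponds to `t`. -/
def actTuple {N : ℕ} {G : Type*} [Group G] (φ : MulAut (FreeSurf N)) (t : Tuple N G) :
    Tuple N G :=
  mapTuple ((tupleHom t).comp (φ⁻¹).toMonoidHom) (genTuple N)

theorem tupleHom_actTuple {N : ℕ} {G : Type*} [Group G] (φ : MulAut (FreeSurf N))
    (t : Tuple N G) : tupleHom (actTuple φ t) = (tupleHom t).comp (φ⁻¹).toMonoidHom := by
  rw [actTuple, tupleHom_mapTuple, tupleHom_gen, MonoidHom.comp_id]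

theorem actTuple_one {N : ℕ} {G : Type*} [Group G] (t : Tuple N G) :
    actTuple (1 : MulAut (FreeSurf N)) t = t := by
  conv_rhs => rw [← mapTuple_tupleHom_gen t]
  rfl

theorem actTuple_mul {N : ℕ} {G : Type*} [Group G] (φ ψ : MulAut (FreeSurf N))
    (t : Tuple N G) : actTuple (φ * ψ) t = actTuple φ (actTuple ψ t) := by
  conv_rhs => rw [actTuple, tupleHom_actTuple]
  rw [actTuple, mul_inv_rev]
  rfl

theorem actTuple_mapTuple {N : ℕ} {G H : Type*} [Group G] [Group H] (φ : MulAut (FreeSurf N))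
    (f : G →* H) (t : Tuple N G) : actTuple φ (mapTuple f t) = mapTuple f (actTuple φ t) := by
  rw [actTuple, tupleHom_mapTuple]
  rfl

theorem multiComm_actTuple {N : ℕ} {G : Type*} [Group G] (φ : MapBdry N) (t : Tuple N G) :
    multiComm (actTuple φ.1 t) = multiComm t := by
  rw [multiComm_eq, multiComm_eq, tupleHom_actTuple]
  exact congrArg (tupleHom t) (mapBdry_boundary φ⁻¹)

/-- The induced map on `C^{2N}_G`. -/
def actClass {N : ℕ} {G : Type*} [Group G] (φ : MulAut (FreeSurf N)) :
    TupleClass N G → TupleClass N G :=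
  Quotient.map (actTuple φ) (by
    intro a b hab
    obtain ⟨c, rfl⟩ := hab
    refine ⟨c, ?_⟩
    dsimp only
    rw [smul_eq_mapTuple, smul_eq_mapTuple, actTuple_mapTuple])

theorem actClass_classOf {N : ℕ} {G : Type*} [Group G] (φ : MulAut (FreeSurf N))
    (t : Tuple N G) : actClass φ (classOf t) = classOf (actTuple φ t) := rfl

theorem actClass_one {N : ℕ} {G : Type*} [Group G] (d : TupleClass N G) :
    actClass 1 d = d := by
  induction d using Quotient.inductionOn with
  | h t => exact congrArg classOf (actTuple_one t)

theorem actClass_mul {N : ℕ} {G : Type*} [Group G] (φ ψ : MulAut (FreeSurf N))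
    (d : TupleClass N G) : actClass (φ * ψ) d = actClass φ (actClass ψ d) := by
  induction d using Quotient.inductionOn with
  | h t => exact congrArg classOf (actTuple_mul φ ψ t)

theorem multiCommClass_actClass {N : ℕ} {G : Type*} [Group G] (φ : MapBdry N)
    (d : TupleClass N G) : multiCommClass (actClass φ.1 d) = multiCommClass d := by
  induction d using Quotient.inductionOn with
  | h t => exact congrArg ConjClasses.mk (multiComm_actTuple φ t)

/-- The action of `Map_{N,1}` on all of `C^{2N}_G`. -/
def sigmaBdry (N : ℕ) (G : Type*) [Group G] : MapBdry N →* Equiv.Perm (TupleClass N G) :=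
  MonoidHom.toHomPerm
    { toFun := fun φ => (actClass φ.1 : Function.End (TupleClass N G))
      map_one' := funext actClass_one
      map_mul' := fun φ ψ => funext (actClass_mul φ.1 ψ.1) }

/-- The action of `Map_{N,1}` on the invariant subset `μ_N⁻¹(c_e)`. -/
def sigmaBdryFlat (N : ℕ) (G : Type*) [Group G] : MapBdry N →* Equiv.Perm (FlatClass N G) :=
  MonoidHom.toHomPerm
    { toFun := fun φ => ((fun d => ⟨sigmaBdry N G φ d.1,
        (multiCommClass_actClass φ d.1).trans d.2⟩) : Function.End (FlatClass N G))
      map_one' := by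
        funext d
        exact Subtype.ext (actClass_one d.1)
      map_mul' := by
        intro φ ψ
        funext d
        exact Subtype.ext (actClass_mul φ.1 ψ.1 d.1) }

theorem capKernel_le_ker (N : ℕ) (G : Type*) [Group G] :
    capKernel N ≤ (sigmaBdryFlat N G).ker := by
  intro φ hφ
  rw [MonoidHom.mem_ker]
  refine Equiv.ext ?_
  rintro ⟨d, hd⟩
  refine Subtype.ext ?_
  change actClass φ.1 d = d
  revert hd
  refine Quotient.inductionOn d (fun t => ?_)
  intro hd
  have hflat : multiComm t = 1 := by
    have h : IsConj (multiComm t) 1 := ConjClasses.mk_eq_mk_iff_isConj.1 hd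
    exact isConj_one_left.1 h
  obtain ⟨c, hc⟩ := (capKernel N).inv_mem hφ
  let r : SurfaceGroup N →* G := PresentedGroup.toGroup
    (f := Sum.elim (fun i => (t i).1) (fun i => (t i).2)) (by
      rintro r rfl
      exact (multiComm_eq t).symm.trans hflat)
  have hr : ∀ x, r (PresentedGroup.mk {boundaryWord N} x) = tupleHom t x := by
    intro x
    have h : r.comp (PresentedGroup.mk {boundaryWord N}) = tupleHom t := by
      ext k
      simp only [MonoidHom.comp_apply, tupleHom, FreeGroup.lift_apply_of]
      exact PresentedGroup.toGroup.of _
    exact DFunLike.congr_fun h x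
  have key : ∀ x, tupleHom t ((φ⁻¹).1 x) = r c * tupleHom t x * (r c)⁻¹ := by
    intro x
    rw [← hr, hc, map_mul, map_mul, map_inv, hr]
  refine classOf_eq_iff.2 ⟨ConjAct.toConjAct (r c), ?_⟩
  rw [smul_eq_mapTuple]
  conv_lhs => rw [← mapTuple_tupleHom_gen t]
  funext i
  exact (Prod.ext (key _) (key _)).symm

/-- The action `σ^N_G` of `Map_N` on `μ_N⁻¹(c_e) ⊆ C^{2N}_G`. -/
def sigma (N : ℕ) (G : Type*) [Group G] : MapClosed N →* Equiv.Perm (FlatClass N G) :=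
  QuotientGroup.lift (capKernel N) (sigmaBdryFlat N G) (capKernel_le_ker N G)

/-- The `Map_N`-orbit of a class. -/
def mapOrbit {N : ℕ} {G : Type*} [Group G] (d : FlatClass N G) : Set (FlatClass N G) :=
  {d' | ∃ φ : MapClosed N, sigma N G φ d = d'}

/-! ## The standard generators

The permutations of tuples by which the inverse Dehn twists about the standard curves and the
modular `S`-transformations act, with the proof that each of them is the action of an element
of `Map_{N,1}`. The position `i` is counted from the left, starting with `0`. -/

section Generators

variable {N : ℕ} {G : Type*} [Group G]

/-- `T : (g|x) ↦ (g|g⁻¹x)` at position `i`. -/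
def moveT (i : Fin N) (t : Tuple N G) : Tuple N G :=
  Function.update t i ((t i).1, (t i).1⁻¹ * (t i).2)

/-- `S : (g|x) ↦ (x⁻¹|x⁻¹gx)` at position `i`. -/
def moveS (i : Fin N) (t : Tuple N G) : Tuple N G :=
  Function.update t i ((t i).2⁻¹, (t i).2⁻¹ * (t i).1 * (t i).2)

/-- `U : (g|x) ↦ (xg|x)` at position `i`. -/
def moveU (i : Fin N) (t : Tuple N G) : Tuple N G :=
  Function.update t i ((t i).2 * (t i).1, (t i).2)

/-- `L : ((g|x),(h|y)) ↦ ((g|xhx⁻¹g⁻¹x),(khk⁻¹|kh⁻¹y))` with `k = x⁻¹gx`, at the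
positions `i`, `j` (where `j = i + 1`). -/
def moveL (i j : Fin N) (t : Tuple N G) : Tuple N G :=
  let g := (t i).1
  let x := (t i).2
  let h := (t j).1
  let y := (t j).2
  let k := x⁻¹ * g * x
  fun l => if l = i then (g, x * h * x⁻¹ * g⁻¹ * x)
    else if l = j then (k * h * k⁻¹, k * h⁻¹ * y) else t l

/-- The part of a tuple to the right of position `i`. -/
def tailTuple (i : Fin N) (t : Tuple N G) : Tuple N G := fun l => if i < l then t l else (1, 1)

/-- `M : ((g|x),(𝐡|𝐲)) ↦ ((g|xc⁻¹),(c𝐡c⁻¹|c𝐲c⁻¹))` with `c = x⁻¹gx · μ(𝐡|𝐲)`, where `(g|x)`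
stands at position `i` and `(𝐡|𝐲)` is the part of the tuple to its right. -/
def moveM (i : Fin N) (t : Tuple N G) : Tuple N G :=
  let g := (t i).1
  let x := (t i).2
  let c := x⁻¹ * g * x * multiComm (tailTuple i t)
  fun l => if l = i then (g, x * c⁻¹)
    else if i < l then (c * (t l).1 * c⁻¹, c * (t l).2 * c⁻¹) else t l

theorem multiComm_succ {n : ℕ} (t : Tuple (n + 1) G) :
    multiComm t = pairComm (t 0) * multiComm (fun l : Fin n => t l.succ) := by
  simp [multiComm, List.ofFn_succ]

theorem multiComm_congr {t u : Tuple N G} (h : ∀ l, pairComm (t l) = pairComm (u l)) :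
    multiComm t = multiComm u := by
  simp [multiComm, h]

theorem multiComm_update (i : Fin N) (t : Tuple N G) (p : G × G)
    (h : pairComm p = pairComm (t i)) : multiComm (Function.update t i p) = multiComm t := by
  refine multiComm_congr fun l => ?_
  by_cases hl : l = i
  · subst hl; simpa using h
  · simp [hl]

theorem multiComm_pair (i j : Fin N) (hij : (j : ℕ) = i + 1) (t u : Tuple N G)
    (h : ∀ l, l ≠ i → l ≠ j → u l = t l)
    (h2 : pairComm (u i) * pairComm (u j) = pairComm (t i) * pairComm (t j)) :
    multiComm u = multiComm t := by
  induction N with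
  | zero => exact i.elim0
  | succ n ih =>
    obtain ⟨j', rfl⟩ : ∃ j' : Fin n, j = j'.succ :=
      Fin.exists_succ_eq.2 (fun h0 => by simp [h0] at hij) |>.imp fun _ h => h.symm
    rw [multiComm_succ, multiComm_succ t]
    by_cases hi : i = 0
    · subst hi
      cases n with
      | zero => exact j'.elim0
      | succ m =>
        have hj : j' = 0 := by
          apply Fin.ext; simpa using hij
        subst hj
        rw [multiComm_succ, multiComm_succ fun l : Fin (m + 1) => t l.succ, ← mul_assoc,
          ← mul_assoc, h2]
        congr 1
        refine multiComm_congr fun l => ?_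
        rw [h l.succ.succ (Fin.succ_ne_zero _)
          (fun hh => Fin.succ_ne_zero _ (Fin.succ_injective _ hh))]
    · obtain ⟨i', rfl⟩ := Fin.exists_succ_eq.2 hi
      rw [h 0 (Fin.succ_ne_zero _).symm (Fin.succ_ne_zero _).symm]
      congr 1
      refine ih i' j' (by simpa using hij) _ _ (fun l h3 h4 => ?_) h2
      exact h l.succ (fun hh => h3 (Fin.succ_injective _ hh))
        (fun hh => h4 (Fin.succ_injective _ hh))

theorem multiComm_tail (i : Fin N) (t u : Tuple N G)
    (h : ∀ l, l < i → u l = t l)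
    (h2 : pairComm (u i) * multiComm (tailTuple i u) =
      pairComm (t i) * multiComm (tailTuple i t)) :
    multiComm u = multiComm t := by
  induction N with
  | zero => exact i.elim0
  | succ n ih =>
    rw [multiComm_succ, multiComm_succ t]
    by_cases hi : i = 0
    · subst hi
      rw [multiComm_succ, multiComm_succ (tailTuple 0 t)] at h2
      simpa [tailTuple, pairComm] using h2
    · obtain ⟨i', rfl⟩ := Fin.exists_succ_eq.2 hi
      rw [h 0 (Fin.succ_pos _)]
      congr 1
      refine ih i' _ _ (fun l hl => h l.succ (Fin.succ_lt_succ_iff.2 hl)) ?_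
      rw [multiComm_succ, multiComm_succ (tailTuple i'.succ t)] at h2
      have h0 : ∀ z : Tuple (n + 1) G, pairComm (tailTuple i'.succ z 0) = 1 := by
        intro z; simp [tailTuple, pairComm]
      have h3 : ∀ z : Tuple (n + 1) G, (fun l : Fin n => tailTuple i'.succ z l.succ) =
          tailTuple i' fun l => z l.succ := by
        intro z; funext l; simp [tailTuple]
      rwa [h0, h0, one_mul, one_mul, h3, h3] at h2

/-- A pair of mutually inverse tuples of words, with multi-commutator the boundary word,
defines an element of `Map_{N,1}`. -/
theorem exists_mapBdry (w w' : Tuple N (FreeSurf N))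
    (h1 : mapTuple (tupleHom w) w' = genTuple N) (h2 : mapTuple (tupleHom w') w = genTuple N)
    (hb : multiComm w = boundaryWord N) (f : Tuple N G → Tuple N G)
    (hf : ∀ t, mapTuple (tupleHom t) w = f t) :
    ∃ φ : MapBdry N, ∀ t : Tuple N G, actTuple φ.1 t = f t := by
  have e1 : (tupleHom w).comp (tupleHom w') = MonoidHom.id _ := by
    rw [← tupleHom_mapTuple, h1, tupleHom_gen]
  have e2 : (tupleHom w').comp (tupleHom w) = MonoidHom.id _ := by
    rw [← tupleHom_mapTuple, h2, tupleHom_gen]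
  let e : MulAut (FreeSurf N) := MonoidHom.toMulEquiv (tupleHom w) (tupleHom w') e2 e1
  have he : e ∈ MapBdry N := by
    change tupleHom w (boundaryWord N) = boundaryWord N
    rw [← multiComm_eq, hb]
  refine ⟨⟨e⁻¹, (MapBdry N).inv_mem he⟩, fun t => ?_⟩
  rw [← hf, actTuple, inv_inv]
  conv_rhs => rw [← mapTuple_tupleHom_gen w]
  rfl

/-- A family of invertible word operations that preserve the multi-commutator is the action of
an element of `Map_{N,1}`. -/
theorem exists_of_natural (X Y : Tuple N (FreeSurf N) → Tuple N (FreeSurf N))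
    (f : Tuple N G → Tuple N G)
    (hX : ∀ (ψ : FreeSurf N →* FreeSurf N) t, mapTuple ψ (X t) = X (mapTuple ψ t))
    (hY : ∀ (ψ : FreeSurf N →* FreeSurf N) t, mapTuple ψ (Y t) = Y (mapTuple ψ t))
    (hf : ∀ (ψ : FreeSurf N →* G) t, mapTuple ψ (X t) = f (mapTuple ψ t))
    (hXY : ∀ t, X (Y t) = t) (hYX : ∀ t, Y (X t) = t)
    (hm : ∀ t, multiComm (X t) = multiComm t) :
    ∃ φ : MapBdry N, ∀ t : Tuple N G, actTuple φ.1 t = f t := by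
  refine exists_mapBdry (X (genTuple N)) (Y (genTuple N)) ?_ ?_ (hm _) f fun t => ?_
  · rw [hY, mapTuple_tupleHom_gen, hYX]
  · rw [hX, mapTuple_tupleHom_gen, hXY]
  · rw [hf, mapTuple_tupleHom_gen]

theorem mapTuple_update {H : Type*} [Group H] (ψ : G →* H) (t : Tuple N G) (i : Fin N)
    (p : G × G) :
    mapTuple ψ (Function.update t i p) = Function.update (mapTuple ψ t) i (ψ p.1, ψ p.2) := by
  funext l
  by_cases hl : l = i
  · subst hl; simp [mapTuple]
  · simp [mapTuple, hl]

theorem exists_moveT (i : Fin N) :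
    ∃ φ : MapBdry N, ∀ t : Tuple N G, actTuple φ.1 t = moveT i t := by
  refine exists_of_natural (moveT i)
    (fun t => Function.update t i ((t i).1, (t i).1 * (t i).2)) _ ?_ ?_ ?_ ?_ ?_ ?_
  · intro ψ t; simp [moveT, mapTuple_update, mapTuple]
  · intro ψ t; simp [mapTuple_update, mapTuple]
  · intro ψ t; simp [moveT, mapTuple_update, mapTuple]
  · intro t; simp [moveT]
  · intro t; simp [moveT]
  · intro t
    refine multiComm_update _ _ _ ?_
    simp only [pairComm]; group

theorem exists_moveS (i : Fin N) :
    ∃ φ : MapBdry N, ∀ t : Tuple N G, actTuple φ.1 t = moveS i t := by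
  refine exists_of_natural (moveS i)
    (fun t => Function.update t i ((t i).1⁻¹ * (t i).2 * (t i).1, (t i).1⁻¹)) _ ?_ ?_ ?_ ?_ ?_ ?_
  · intro ψ t; simp [moveS, mapTuple_update, mapTuple]
  · intro ψ t; simp [mapTuple_update, mapTuple]
  · intro ψ t; simp [moveS, mapTuple_update, mapTuple]
  · intro t; simp [moveS, mul_assoc]
  · intro t; simp [moveS, mul_assoc]
  · intro t
    refine multiComm_update _ _ _ ?_
    simp only [pairComm]; group

theorem exists_moveU (i : Fin N) :
    ∃ φ : MapBdry N, ∀ t : Tuple N G, actTuple φ.1 t = moveU i t := by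
  refine exists_of_natural (moveU i)
    (fun t => Function.update t i ((t i).2⁻¹ * (t i).1, (t i).2)) _ ?_ ?_ ?_ ?_ ?_ ?_
  · intro ψ t; simp [moveU, mapTuple_update, mapTuple]
  · intro ψ t; simp [mapTuple_update, mapTuple]
  · intro ψ t; simp [moveU, mapTuple_update, mapTuple]
  · intro t; simp [moveU]
  · intro t; simp [moveU]
  · intro t
    refine multiComm_update _ _ _ ?_
    simp only [pairComm]; group

theorem mapTuple_moveL {H : Type*} [Group H] (ψ : G →* H) (i j : Fin N) (t : Tuple N G) :
    mapTuple ψ (moveL i j t) = moveL i j (mapTuple ψ t) := by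
  funext l
  by_cases hl : l = i
  · simp [mapTuple, moveL, hl]
  · by_cases hl' : l = j
    · subst hl'
      simp [mapTuple, moveL, hl]
    · simp [mapTuple, moveL, hl, hl']

/-- The inverse of `moveL`. -/
def moveLInv (i j : Fin N) (t : Tuple N G) : Tuple N G :=
  let g := (t i).1
  let x := (t i).2
  let h := (t j).1
  let y := (t j).2
  let k := h * (x⁻¹ * g * x) * h⁻¹
  fun l => if l = i then (g, x * h⁻¹ * k)
    else if l = j then (k⁻¹ * h * k, k⁻¹ * h * y) else t l

theorem mapTuple_moveLInv {H : Type*} [Group H] (ψ : G →* H) (i j : Fin N) (t : Tuple N G) :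
    mapTuple ψ (moveLInv i j t) = moveLInv i j (mapTuple ψ t) := by
  funext l
  by_cases hl : l = i
  · simp [mapTuple, moveLInv, hl]
  · by_cases hl' : l = j
    · subst hl'
      simp [mapTuple, moveLInv, hl]
    · simp [mapTuple, moveLInv, hl, hl']

theorem exists_moveL (i j : Fin N) (hij : (j : ℕ) = i + 1) :
    ∃ φ : MapBdry N, ∀ t : Tuple N G, actTuple φ.1 t = moveL i j t := by
  have hne : j ≠ i := fun h => by rw [h] at hij; omega
  refine exists_of_natural (moveL i j) (moveLInv i j) _
    (fun ψ t => mapTuple_moveL ψ i j t) (fun ψ t => mapTuple_moveLInv ψ i j t)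
    (fun ψ t => mapTuple_moveL ψ i j t) ?_ ?_ ?_
  · intro t
    funext l
    by_cases hl : l = i
    · subst hl
      simp only [moveL, moveLInv, if_true, hne, if_false]
      refine Prod.ext rfl ?_
      dsimp only; group
    · by_cases hl' : l = j
      · subst hl'
        simp only [moveL, moveLInv, if_true, hne, if_false]
        refine Prod.ext ?_ ?_ <;> dsimp only <;> group
      · simp [moveL, moveLInv, hl, hl']
  · intro t
    funext l
    by_cases hl : l = i
    · subst hl
      simp only [moveL, moveLInv, if_true, hne, if_false]
      refine Prod.ext rfl ?_
      dsimp only; group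
    · by_cases hl' : l = j
      · subst hl'
        simp only [moveL, moveLInv, if_true, hne, if_false]
        refine Prod.ext ?_ ?_ <;> dsimp only <;> group
      · simp [moveL, moveLInv, hl, hl']
  · intro t
    refine multiComm_pair i j hij _ _ (fun l h1 h2 => by simp [moveL, h1, h2]) ?_
    simp only [moveL, if_true, hne, if_false, pairComm]
    group

theorem tailTuple_moveM (i : Fin N) (t : Tuple N G) :
    tailTuple i (moveM i t) = mapTuple (MulAut.conj
      ((t i).2⁻¹ * (t i).1 * (t i).2 * multiComm (tailTuple i t))).toMonoidHom
      (tailTuple i t) := by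
  funext l
  by_cases hl : i < l
  · simp [tailTuple, moveM, mapTuple, hl, hl.ne', mul_assoc]
  · simp [tailTuple, mapTuple, hl]

/-- The inverse of `moveM`. -/
def moveMInv (i : Fin N) (t : Tuple N G) : Tuple N G :=
  let g := (t i).1
  let x := (t i).2
  let c := x⁻¹ * g * x * multiComm (tailTuple i t)
  fun l => if l = i then (g, x * c)
    else if i < l then (c⁻¹ * (t l).1 * c, c⁻¹ * (t l).2 * c) else t l

theorem tailTuple_moveMInv (i : Fin N) (t : Tuple N G) :
    tailTuple i (moveMInv i t) = mapTuple (MulAut.conj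
      ((t i).2⁻¹ * (t i).1 * (t i).2 * multiComm (tailTuple i t))⁻¹).toMonoidHom
      (tailTuple i t) := by
  funext l
  by_cases hl : i < l
  · simp [tailTuple, moveMInv, mapTuple, hl, hl.ne', mul_assoc]
  · simp [tailTuple, mapTuple, hl]

theorem mapTuple_tailTuple {H : Type*} [Group H] (ψ : G →* H) (i : Fin N) (t : Tuple N G) :
    mapTuple ψ (tailTuple i t) = tailTuple i (mapTuple ψ t) := by
  funext l
  by_cases hl : i < l <;> simp [tailTuple, mapTuple, hl]

theorem mapTuple_moveM {H : Type*} [Group H] (ψ : G →* H) (i : Fin N) (t : Tuple N G) :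
    mapTuple ψ (moveM i t) = moveM i (mapTuple ψ t) := by
  have hc := multiComm_map ψ (tailTuple i t)
  rw [mapTuple_tailTuple] at hc
  funext l
  simp only [moveM, hc]
  by_cases hl : l = i
  · simp [mapTuple, hl]
  · by_cases hl' : i < l <;> simp [mapTuple, hl, hl']

theorem mapTuple_moveMInv {H : Type*} [Group H] (ψ : G →* H) (i : Fin N) (t : Tuple N G) :
    mapTuple ψ (moveMInv i t) = moveMInv i (mapTuple ψ t) := by
  have hc := multiComm_map ψ (tailTuple i t)
  rw [mapTuple_tailTuple] at hc
  funext l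
  simp only [moveMInv, hc]
  by_cases hl : l = i
  · simp [mapTuple, hl]
  · by_cases hl' : i < l <;> simp [mapTuple, hl, hl']

theorem exists_moveM (i : Fin N) :
    ∃ φ : MapBdry N, ∀ t : Tuple N G, actTuple φ.1 t = moveM i t := by
  refine exists_of_natural (moveM i) (moveMInv i) _
    (fun ψ t => mapTuple_moveM ψ i t) (fun ψ t => mapTuple_moveMInv ψ i t)
    (fun ψ t => mapTuple_moveM ψ i t) ?_ ?_ ?_
  · intro t
    have h := tailTuple_moveMInv i t
    set c := (t i).2⁻¹ * (t i).1 * (t i).2 * multiComm (tailTuple i t) with hc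
    have hi : moveMInv i t i = ((t i).1, (t i).2 * c) := by simp [moveMInv, hc]
    have h2 : ((t i).2 * c)⁻¹ * (t i).1 * ((t i).2 * c) *
        multiComm (tailTuple i (moveMInv i t)) = c := by
      rw [h, multiComm_map]
      simp only [MulEquiv.toMonoidHom_eq_coe, MonoidHom.coe_coe, MulAut.conj_apply]
      rw [hc]; group
    funext l
    rw [moveM, hi]
    simp only [h2]
    by_cases hl : l = i
    · subst hl; simp
    · by_cases hl' : i < l
      · simp only [hl, hl', if_true, if_false, moveMInv, ← hc]
        refine Prod.ext ?_ ?_ <;> dsimp only <;> group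
      · simp [hl, hl', moveMInv]
  · intro t
    have h := tailTuple_moveM i t
    set c := (t i).2⁻¹ * (t i).1 * (t i).2 * multiComm (tailTuple i t) with hc
    have hi : moveM i t i = ((t i).1, (t i).2 * c⁻¹) := by simp [moveM, hc]
    have h2 : ((t i).2 * c⁻¹)⁻¹ * (t i).1 * ((t i).2 * c⁻¹) *
        multiComm (tailTuple i (moveM i t)) = c := by
      rw [h, multiComm_map]
      simp only [MulEquiv.toMonoidHom_eq_coe, MonoidHom.coe_coe, MulAut.conj_apply]
      rw [hc]; group
    funext l
    rw [moveMInv, hi]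
    simp only [h2]
    by_cases hl : l = i
    · subst hl; simp
    · by_cases hl' : i < l
      · simp only [hl, hl', if_true, if_false, moveM, ← hc]
        refine Prod.ext ?_ ?_ <;> dsimp only <;> group
      · simp [hl, hl', moveM]
  · intro t
    refine multiComm_tail i _ _ (fun l hl => by simp [moveM, hl.ne, hl.not_gt]) ?_
    rw [tailTuple_moveM, multiComm_map]
    simp only [moveM, if_true, pairComm, MulEquiv.toMonoidHom_eq_coe, MonoidHom.coe_coe,
      MulAut.conj_apply]
    group

end Generators

/-! ## Tuples of powers of one element -/

/-- The tuple `((g^{m₁}|g^{n₁}),…,(g^{m_N}|g^{n_N}))`, where `m_i = v (inl i)` and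
`n_i = v (inr i)`. -/
def powerTuple {N : ℕ} {G : Type*} [Group G] (g : G) (v : Fin N ⊕ Fin N → ℤ) : Tuple N G :=
  fun i => (g ^ v (Sum.inl i), g ^ v (Sum.inr i))

theorem multiComm_powerTuple {N : ℕ} {G : Type*} [Group G] (g : G) (v : Fin N ⊕ Fin N → ℤ) :
    multiComm (powerTuple g v) = 1 := by
  have h : ∀ i, pairComm (powerTuple g v i) = 1 := by
    intro i
    simp only [pairComm, powerTuple, ← zpow_neg, ← zpow_add]
    ring_nf
    exact zpow_zero g
  simp [multiComm, h]

/-- The `2N`-conjugacy class of a tuple of powers of `g`. -/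
def powerClass {N : ℕ} {G : Type*} [Group G] (g : G) (v : Fin N ⊕ Fin N → ℤ) :
    FlatClass N G :=
  ⟨classOf (powerTuple g v), congrArg ConjClasses.mk (multiComm_powerTuple g v)⟩

/-- The set of `2N`-conjugacy classes of tuples of powers of `g`. -/
def powerClasses (N : ℕ) {G : Type*} [Group G] (g : G) : Set (FlatClass N G) :=
  Set.range (powerClass (N := N) g)

/-- `gcd(m₁,…,m_N,n₁,…,n_N,o(g))`. -/
noncomputable def expGcd {N : ℕ} {G : Type*} [Group G] (g : G) (v : Fin N ⊕ Fin N → ℤ) : ℕ :=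
  Nat.gcd (Finset.univ.gcd fun k => (v k).natAbs) (orderOf g)

/-! ## The symplectic representation -/

/-- The exponent sum of the `l`-th generator in a word. -/
def exponentSum {N : ℕ} (l : Fin N ⊕ Fin N) : FreeSurf N →* Multiplicative ℤ :=
  FreeGroup.lift fun k => Multiplicative.ofAdd (if k = l then 1 else 0)

/-- The matrix by which a mapping class `φ` acts, via `f ↦ f ∘ φ⁻¹`, on the first cohomology
group `Hom(π₁, ℤ) ≅ ℤ^{2N}` of the surface, written in the basis dual to the standard
generators. By Poincaré duality this is the action on first homology. -/
def homologyMatrix {N : ℕ} (φ : MapBdry N) : Matrix (Fin N ⊕ Fin N) (Fin N ⊕ Fin N) ℤ :=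
  Matrix.of fun k l => (exponentSum l ((φ⁻¹).1 (FreeGroup.of k))).toAdd

/-- The orbit of a vector under the defining action of `Sp(2N, R)` on `R^{2N}`. -/
def spOrbit {N : ℕ} {R : Type*} [CommRing R] (z : Fin N ⊕ Fin N → R) :
    Set (Fin N ⊕ Fin N → R) :=
  {w | ∃ A : Matrix.symplecticGroup (Fin N) R, A.1.mulVec z = w}

end MCG

/-!
A mapping class `φ` acts on tuples of powers of `g` by multiplying the vector of exponents by the
integral matrix of its action on `H¹(Σ_N; ℤ)`. For `g` a generator of `ℤ` this recovers the matrix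
from the action on classes of tuples, so the matrix is multiplicative in `φ` and depends only on
the image of `φ` in the mapping class group of the closed surface. It is symplectic because `φ`
fixes the boundary word: the free group maps to a Heisenberg group over the outer product on
`ℤ^{2N}`, where the product of commutators of a tuple is central and records the pullback of the
symplectic form.

Conversely, explicit mapping classes add one coordinate of a handle to the other and, up to a
rotation of a handle, first coordinates of neighbouring handles to each other. The Euclidean
algorithm then moves every exponent vector to `(e, 0, …, 0)`. Since exponents only matter modulo
the order of `g`, a last run on `(e, o(g))` replaces `e` by `gcd(e, o(g))`, which is the
invariant `γ`.
-/

namespace MCG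

open Function
open scoped Matrix MatrixGroups

/-! ## Heisenberg groups -/

/-- The Heisenberg group of a bilinear map `β`: the central extension of `V` by `Z` with
cocycle `β`. -/
@[ext]
structure Heisenberg {R V Z : Type*} [CommRing R] [AddCommGroup V] [Module R V] [AddCommGroup Z]
    [Module R Z] (β : V →ₗ[R] V →ₗ[R] Z) where
  base : V
  central : Z

namespace Heisenberg

variable {R V Z : Type*} [CommRing R] [AddCommGroup V] [Module R V] [AddCommGroup Z] [Module R Z]
  {β : V →ₗ[R] V →ₗ[R] Z}

instance : Mul (Heisenberg β) :=
  ⟨fun p q => ⟨p.base + q.base, p.central + q.central + β p.base q.base⟩⟩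

instance : One (Heisenberg β) := ⟨⟨0, 0⟩⟩

instance : Inv (Heisenberg β) := ⟨fun p => ⟨-p.base, -p.central + β p.base p.base⟩⟩

@[simp] theorem base_mul (p q : Heisenberg β) : (p * q).base = p.base + q.base := rfl
@[simp] theorem base_one : (1 : Heisenberg β).base = 0 := rfl
@[simp] theorem base_inv (p : Heisenberg β) : p⁻¹.base = -p.base := rfl
@[simp] theorem central_mul (p q : Heisenberg β) :
    (p * q).central = p.central + q.central + β p.base q.base := rfl
@[simp] theorem central_one : (1 : Heisenberg β).central = 0 := rfl
@[simp] theorem central_inv (p : Heisenberg β) :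
    p⁻¹.central = -p.central + β p.base p.base := rfl

instance : Group (Heisenberg β) where
  mul_assoc p q r := by
    ext
    · simp [add_assoc]
    · simp only [central_mul, base_mul, map_add, LinearMap.add_apply]
      abel
  one_mul p := by ext <;> simp
  mul_one p := by ext <;> simp
  inv_mul_cancel p := by ext <;> simp

theorem pairComm_eq (p : Heisenberg β × Heisenberg β) :
    pairComm p = ⟨0, β p.1.base p.2.base - β p.2.base p.1.base⟩ := by
  ext
  · simp [pairComm]
  · simp only [pairComm, central_mul, base_mul, central_inv, base_inv, map_add, map_neg,
      LinearMap.add_apply, LinearMap.neg_apply]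
    abel

theorem multiComm_eq {N : ℕ} (t : Tuple N (Heisenberg β)) :
    multiComm t =
      ⟨0, ∑ i, (β (t i).1.base (t i).2.base - β (t i).2.base (t i).1.base)⟩ := by
  induction N with
  | zero => rfl
  | succ n ih =>
    rw [multiComm_succ, ih, pairComm_eq, Fin.sum_univ_succ]
    ext1 <;> simp

end Heisenberg

/-! ## Symplecticity of the action on homology -/

theorem toAdd_exponentSum_of {N : ℕ} (l k : Fin N ⊕ Fin N) :
    (exponentSum l (FreeGroup.of k)).toAdd = Pi.single (M := fun _ => ℤ) k 1 l := by
  simp [exponentSum, Pi.single_apply, eq_comm]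

/-- The generic tuple of the Heisenberg group of the outer product on `ℤ^{2N}`. The associated
homomorphism is the Magnus expansion of `F_{2N}`, truncated in degree three. -/
def magnusTuple (N : ℕ) :
    Tuple N (Heisenberg (vecMulVecBilin ℤ ℤ (m := Fin N ⊕ Fin N) (n := Fin N ⊕ Fin N) (A := ℤ))) :=
  fun i => (⟨Pi.single (Sum.inl i) 1, 0⟩, ⟨Pi.single (Sum.inr i) 1, 0⟩)

theorem base_tupleHom_magnusTuple {N : ℕ} (x : FreeSurf N) :
    (tupleHom (magnusTuple N) x).base = fun l => (exponentSum l x).toAdd := by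
  induction x using FreeGroup.induction_on with
  | C1 => rw [map_one]; rfl
  | of k =>
    ext l
    rw [toAdd_exponentSum_of]
    rcases k with k | k <;> simp [tupleHom, magnusTuple]
  | inv_of k h => simp only [map_inv, Heisenberg.base_inv, h]; rfl
  | mul x y hx hy => simp only [map_mul, Heisenberg.base_mul, hx, hy]; rfl

theorem transpose_mul_J_mul {ι R : Type*} [Fintype ι] [DecidableEq ι] [CommRing R]
    (A : Matrix (ι ⊕ ι) (ι ⊕ ι) R) :
    Aᵀ * Matrix.J ι R * A = ∑ i, (Matrix.vecMulVec (A (Sum.inr i)) (A (Sum.inl i)) -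
      Matrix.vecMulVec (A (Sum.inl i)) (A (Sum.inr i))) := by
  ext k l
  simp only [Matrix.J, Matrix.mul_apply, Matrix.transpose_apply, Fintype.sum_sum_type,
    Matrix.fromBlocks_apply₁₁, Matrix.fromBlocks_apply₁₂, Matrix.fromBlocks_apply₂₁,
    Matrix.fromBlocks_apply₂₂, Matrix.zero_apply, Matrix.neg_apply, Matrix.one_apply, mul_zero,
    mul_neg, mul_ite, mul_one, Finset.sum_neg_distrib, Finset.sum_const_zero, Finset.sum_ite_eq',
    Finset.mem_univ, if_true, zero_add, add_zero, neg_mul, Matrix.sum_apply, Matrix.sub_apply,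
    Matrix.vecMulVec_apply, Finset.sum_sub_distrib]
  abel

theorem multiComm_actTuple_magnusTuple {N : ℕ} (φ : MapBdry N) :
    multiComm (actTuple φ.1 (magnusTuple N)) =
      ⟨0, -((homologyMatrix φ)ᵀ * Matrix.J (Fin N) ℤ * homologyMatrix φ)⟩ := by
  rw [Heisenberg.multiComm_eq, transpose_mul_J_mul, ← Finset.sum_neg_distrib]
  simp only [neg_sub, actTuple, mapTuple, genTuple, MonoidHom.comp_apply, base_tupleHom_magnusTuple]
  rfl

theorem homologyMatrix_one (N : ℕ) : homologyMatrix (1 : MapBdry N) = 1 := by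
  ext k l
  exact (toAdd_exponentSum_of l k).trans (by simp [Matrix.one_apply, Pi.single_apply, eq_comm])

theorem homologyMatrix_mem_symplecticGroup {N : ℕ} (φ : MapBdry N) :
    homologyMatrix φ ∈ Matrix.symplecticGroup (Fin N) ℤ := by
  have h : multiComm (actTuple φ.1 (magnusTuple N)) =
      multiComm (actTuple (1 : MapBdry N).1 (magnusTuple N)) := by
    rw [multiComm_actTuple, multiComm_actTuple]
  rw [multiComm_actTuple_magnusTuple, multiComm_actTuple_magnusTuple, homologyMatrix_one] at h
  simpa [SymplecticGroup.mem_iff'] using h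

/-! ## The action on tuples of powers -/

section PowerTuples

variable {N : ℕ} {G : Type*} [Group G] {g : G} {v w : Fin N ⊕ Fin N → ℤ}

theorem tupleHom_powerTuple (g : G) (v : Fin N ⊕ Fin N → ℤ) (x : FreeSurf N) :
    tupleHom (powerTuple g v) x = g ^ ((fun l => (exponentSum l x).toAdd) ⬝ᵥ v) := by
  induction x using FreeGroup.induction_on with
  | C1 => simp [dotProduct]
  | of k =>
    simp only [toAdd_exponentSum_of, single_one_dotProduct]
    rcases k with k | k <;> simp [tupleHom, powerTuple]
  | inv_of k h =>
    simp only [map_inv, h, toAdd_inv, ← zpow_neg, dotProduct, neg_mul, Finset.sum_neg_distrib]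
  | mul x y hx hy =>
    simp only [map_mul, hx, hy, toAdd_mul, ← zpow_add, dotProduct, add_mul, Finset.sum_add_distrib]

theorem actTuple_powerTuple (φ : MapBdry N) (g : G) (v : Fin N ⊕ Fin N → ℤ) :
    actTuple φ.1 (powerTuple g v) = powerTuple g (homologyMatrix φ *ᵥ v) :=
  funext fun _ => Prod.ext (tupleHom_powerTuple g v _) (tupleHom_powerTuple g v _)

theorem sigma_mk_powerClass (φ : MapBdry N) (g : G) (v : Fin N ⊕ Fin N → ℤ) :
    sigma N G (QuotientGroup.mk φ) (powerClass g v) = powerClass g (homologyMatrix φ *ᵥ v) :=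
  Subtype.ext (congrArg classOf (actTuple_powerTuple φ g v))

theorem powerClass_eq_iff :
    powerClass g v = powerClass g w ↔ ∃ c, ∀ k, SemiconjBy c (g ^ w k) (g ^ v k) := by
  simp only [SemiconjBy, ← mul_inv_eq_iff_eq_mul]
  refine Subtype.ext_iff.trans (classOf_eq_iff.trans ?_)
  simp only [smul_eq_mapTuple]
  constructor
  · rintro ⟨c, hc⟩
    exact ⟨ConjAct.ofConjAct c, Sum.rec (fun i => congrArg Prod.fst (congrFun hc i))
      fun i => congrArg Prod.snd (congrFun hc i)⟩
  · rintro ⟨c, hc⟩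
    exact ⟨ConjAct.toConjAct c, funext fun i => Prod.ext (hc (Sum.inl i)) (hc (Sum.inr i))⟩

theorem powerClass_mulVec_congr (A : Matrix (Fin N ⊕ Fin N) (Fin N ⊕ Fin N) ℤ)
    (h : powerClass g v = powerClass g w) :
    powerClass g (A *ᵥ v) = powerClass g (A *ᵥ w) := by
  obtain ⟨c, hc⟩ := powerClass_eq_iff.1 h
  refine powerClass_eq_iff.2 ⟨c, fun k => ?_⟩
  have hsum : ∀ s : Finset (Fin N ⊕ Fin N),
      SemiconjBy c (g ^ ∑ l ∈ s, A k l * w l) (g ^ ∑ l ∈ s, A k l * v l) := by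
    intro s
    induction s using Finset.cons_induction with
    | empty => simp
    | cons l s hl ih =>
      simp only [Finset.sum_cons, zpow_add, mul_comm (A k l), zpow_mul]
      exact ((hc l).zpow_right (A k l)).mul_right ih
  exact hsum Finset.univ

end PowerTuples

section SymplecticRep

variable {N : ℕ}

theorem eq_of_powerClass_mulVec_eq {A B : Matrix (Fin N ⊕ Fin N) (Fin N ⊕ Fin N) ℤ}
    (h : ∀ v, powerClass (Multiplicative.ofAdd (1 : ℤ)) (A *ᵥ v) =
      powerClass (Multiplicative.ofAdd (1 : ℤ)) (B *ᵥ v)) : A = B := by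
  refine Matrix.ext_of_mulVec_single fun k => funext fun l => ?_
  obtain ⟨c, hc⟩ := powerClass_eq_iff.1 (h (Pi.single k 1))
  simpa [← ofAdd_zsmul] using (semiconjBy_iff_eq.1 (hc l)).symm

theorem homologyMatrix_mul (φ ψ : MapBdry N) :
    homologyMatrix (φ * ψ) = homologyMatrix φ * homologyMatrix ψ := by
  refine eq_of_powerClass_mulVec_eq fun v => ?_
  rw [← Matrix.mulVec_mulVec]
  simp only [← sigma_mk_powerClass, QuotientGroup.mk_mul, map_mul, Equiv.Perm.mul_apply]

theorem homologyMatrix_eq_one {φ : MapBdry N} (hφ : φ ∈ capKernel N) : homologyMatrix φ = 1 := by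
  refine eq_of_powerClass_mulVec_eq fun v => ?_
  rw [← sigma_mk_powerClass, (QuotientGroup.eq_one_iff φ).2 hφ, map_one, Equiv.Perm.one_apply,
    Matrix.one_mulVec]

/-- The symplectic representation of the mapping class group of the closed surface of genus `N`,
its action on `H¹(Σ_N; ℤ)`. -/
def symplecticRep (N : ℕ) : MapClosed N →* Matrix.symplecticGroup (Fin N) ℤ :=
  QuotientGroup.lift (capKernel N)
    { toFun := fun φ => ⟨homologyMatrix φ, homologyMatrix_mem_symplecticGroup φ⟩
      map_one' := Subtype.ext (homologyMatrix_one N)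
      map_mul' := fun φ ψ => Subtype.ext (homologyMatrix_mul φ ψ) }
    fun _ hφ => Subtype.ext (homologyMatrix_eq_one hφ)

end SymplecticRep

section SymplecticAction

variable {N : ℕ} {G : Type*} [Group G]

/-- The action of integral matrices on the classes of tuples of powers of `g`, by
`A • [g^v] = [g^{Av}]`. -/
noncomputable def matrixAct (g : G) (A : Matrix (Fin N ⊕ Fin N) (Fin N ⊕ Fin N) ℤ)
    (d : powerClasses N g) : powerClasses N g :=
  ⟨powerClass g (A *ᵥ Set.rangeSplitting (powerClass g) d), Set.mem_range_self _⟩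

theorem matrixAct_powerClass (g : G) (A : Matrix (Fin N ⊕ Fin N) (Fin N ⊕ Fin N) ℤ)
    (v : Fin N ⊕ Fin N → ℤ) :
    matrixAct g A ⟨powerClass g v, Set.mem_range_self v⟩ =
      ⟨powerClass g (A *ᵥ v), Set.mem_range_self _⟩ :=
  Subtype.ext (powerClass_mulVec_congr A (Set.apply_rangeSplitting _ _))

theorem matrixAct_one (g : G) (d : powerClasses N g) : matrixAct g 1 d = d := by
  obtain ⟨_, v, rfl⟩ := d
  simp only [matrixAct_powerClass, Matrix.one_mulVec]

theorem matrixAct_mul (g : G) (A B : Matrix (Fin N ⊕ Fin N) (Fin N ⊕ Fin N) ℤ)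
    (d : powerClasses N g) : matrixAct g (A * B) d = matrixAct g A (matrixAct g B d) := by
  obtain ⟨_, v, rfl⟩ := d
  simp only [matrixAct_powerClass, Matrix.mulVec_mulVec]

/-- The action of the symplectic group on the classes of tuples of powers of `g`. -/
noncomputable def symplecticAct (N : ℕ) (g : G) :
    Matrix.symplecticGroup (Fin N) ℤ →* Equiv.Perm (powerClasses N g) :=
  MonoidHom.toHomPerm
    { toFun := fun A => (matrixAct g A.1 : Function.End (powerClasses N g))
      map_one' := funext (matrixAct_one g)
      map_mul' := fun A B => funext (matrixAct_mul g A.1 B.1) }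

theorem sigma_eq_symplecticAct (g : G) (φ : MapClosed N) (d : powerClasses N g) :
    sigma N G φ d.1 = (symplecticAct N g (symplecticRep N φ) d).1 := by
  obtain ⟨_, v, rfl⟩ := d
  obtain ⟨φ, rfl⟩ := QuotientGroup.mk_surjective φ
  exact (sigma_mk_powerClass φ g v).trans
    (congrArg Subtype.val (matrixAct_powerClass g (homologyMatrix φ) v)).symm

end SymplecticAction

/-! ## The Euclidean algorithm by transvections -/

section EuclideanReduction

theorem rel_mulVec_of_transvections {r : Setoid (Fin 2 → ℤ)}
    (h₁ : ∀ a b, r ![a, b] ![a + b, b]) (h₂ : ∀ a b, r ![a, b] ![a, b + a]) (γ : SL(2, ℤ))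
    (u : Fin 2 → ℤ) : r u (γ.1 *ᵥ u) := by
  have hγ : γ ∈ Subgroup.closure {ModularGroup.S, ModularGroup.T} :=
    SpecialLinearGroup.SL2Z_generators ▸ Subgroup.mem_top γ
  induction hγ using Subgroup.closure_induction generalizing u with
  | mem γ hγ =>
    obtain ⟨a, b, rfl⟩ : ∃ a b, u = ![a, b] := ⟨u 0, u 1, by ext i; fin_cases i <;> rfl⟩
    rw [Matrix.mulVec_fin_two]
    rcases hγ with rfl | rfl
    · have h : r ![a, b + a] ![-b, b + a] := by simpa using r.symm (h₁ (-b) (b + a))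
      have h' : r ![-b, b + a] ![-b, a] := by simpa using h₂ (-b) (b + a)
      simpa [ModularGroup.S] using r.trans (h₂ a b) (r.trans h h')
    · simpa [ModularGroup.T] using h₁ a b
  | one => rw [Matrix.SpecialLinearGroup.coe_one, Matrix.one_mulVec]
  | mul γ δ _ _ hγ hδ =>
    rw [Matrix.SpecialLinearGroup.coe_mul, ← Matrix.mulVec_mulVec]
    exact r.trans (hδ u) (hγ _)
  | inv γ _ h =>
    have h' := h (γ⁻¹.1 *ᵥ u)
    rw [Matrix.mulVec_mulVec, ← Matrix.SpecialLinearGroup.coe_mul, mul_inv_cancel,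
      Matrix.SpecialLinearGroup.coe_one, Matrix.one_mulVec] at h'
    exact r.symm h'

theorem rel_gcd_of_transvections {r : Setoid (Fin 2 → ℤ)}
    (h₁ : ∀ a b, r ![a, b] ![a + b, b]) (h₂ : ∀ a b, r ![a, b] ![a, b + a]) (a b : ℤ) :
    r ![a, b] ![(Int.gcd a b : ℤ), 0] := by
  obtain ⟨a', b', ha, hb, hab⟩ := extract_gcd a b
  obtain ⟨γ, hγa, hγb⟩ := ((gcd_isUnit_iff a' b').1 hab).exists_SL2_col 0
  have hγ : γ.1 *ᵥ ![(Int.gcd a b : ℤ), 0] = ![a, b] := by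
    simp only [Matrix.mulVec_fin_two, Int.coe_gcd, hγa, hγb, Matrix.cons_val_zero,
      Matrix.cons_val_one, mul_zero, add_zero, mul_comm _ (gcd a b), ← ha, ← hb]
  exact r.symm (hγ ▸ rel_mulVec_of_transvections h₁ h₂ γ ![(Int.gcd a b : ℤ), 0])

theorem rel_update_gcd {α : Type*} [DecidableEq α] {r : Setoid (α → ℤ)} {i j : α} (hij : i ≠ j)
    (h₁ : ∀ v, r v (update v i (v i + v j))) (h₂ : ∀ v, r v (update v j (v j + v i)))
    (v : α → ℤ) : r v (update (update v i (Int.gcd (v i) (v j))) j 0) := by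
  have h := rel_gcd_of_transvections
    (r := r.comap fun u : Fin 2 → ℤ => update (update v i (u 0)) j (u 1))
    (fun a b => ?_) (fun a b => ?_) (v i) (v j)
  · simpa [Setoid.comap_rel] using h
  · have := h₁ (update (update v i a) j b)
    simpa [Setoid.comap_rel, hij, update_comm hij.symm] using this
  · have := h₂ (update (update v i a) j b)
    simpa [Setoid.comap_rel, hij] using this

theorem rel_single_of_adjacent_transvections {n : ℕ} {r : Setoid (Fin (n + 1) → ℤ)}
    (h₁ : ∀ (i : Fin n) v, r v (update v i.castSucc (v i.castSucc + v i.succ)))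
    (h₂ : ∀ (i : Fin n) v, r v (update v i.succ (v i.succ + v i.castSucc)))
    (v : Fin (n + 1) → ℤ) : ∃ e, r v (Pi.single 0 e) := by
  induction n with
  | zero =>
    have hv : Pi.single 0 (v 0) = v := funext fun i => by rw [Fin.eq_zero i, Pi.single_eq_same]
    exact ⟨v 0, hv.symm ▸ r.refl v⟩
  | succ n ih =>
    obtain ⟨u, hu⟩ : ∃ u : Fin (n + 1) → ℤ, r v (Fin.snoc u 0) := by
      have h := rel_update_gcd (Fin.castSucc_ne_last (Fin.last n)) (h₁ (Fin.last n))
        (h₂ (Fin.last n)) v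
      rw [← Fin.snoc_init_self (update v _ _), Fin.update_snoc_last] at h
      exact ⟨_, h⟩
    obtain ⟨e, he⟩ := ih (r := r.comap fun u => Fin.snoc u 0)
      (fun i u => by
        simpa only [Setoid.comap_rel, Fin.snoc_update, Fin.succ_castSucc, Fin.snoc_castSucc]
          using h₁ i.castSucc (Fin.snoc u 0))
      (fun i u => by
        simpa only [Setoid.comap_rel, Fin.snoc_update, Fin.succ_castSucc, Fin.snoc_castSucc]
          using h₂ i.castSucc (Fin.snoc u 0)) u
    have hsnoc : Fin.snoc (Pi.single 0 e) 0 = (Pi.single 0 e : Fin (n + 2) → ℤ) := by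
      ext i
      cases i using Fin.lastCases with
      | last => simp
      | cast i => simp [Pi.single_apply]
    exact ⟨e, r.trans hu (hsnoc ▸ he)⟩

end EuclideanReduction

/-! ## Orbits of exponent vectors -/

section GcdInvariance

variable {N : ℕ} {G : Type*} [Group G] {g : G} {v w : Fin N ⊕ Fin N → ℤ}

theorem powerTuple_eq_iff : powerTuple g v = powerTuple g w ↔
    (fun k => (v k : ZMod (orderOf g))) = fun k => (w k : ZMod (orderOf g)) := by
  simp only [funext_iff, powerTuple, Prod.ext_iff, zpow_eq_zpow_iff_modEq,
    ZMod.intCast_eq_intCast_iff, Sum.forall, forall_and]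

theorem dvd_expGcd_iff {d : ℕ} :
    d ∣ expGcd g v ↔ (∀ k, (d : ℤ) ∣ v k) ∧ d ∣ orderOf g := by
  simp [expGcd, Nat.dvd_gcd_iff, Finset.dvd_gcd_iff, Int.natCast_dvd]

theorem expGcd_single (g : G) (k : Fin N ⊕ Fin N) (e : ℤ) :
    expGcd g (Pi.single k e) = Int.gcd e (orderOf g) := by
  refine Nat.dvd_left_iff_eq.1 fun d => ?_
  rw [dvd_expGcd_iff, Int.dvd_gcd_iff, Int.natCast_dvd_natCast]
  refine and_congr_left' ⟨fun h => by simpa using h k, fun h l => ?_⟩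
  obtain rfl | hl := eq_or_ne l k <;> simp [*]

theorem expGcd_dvd_of_mulVec_eq {A : Matrix (Fin N ⊕ Fin N) (Fin N ⊕ Fin N) (ZMod (orderOf g))}
    (h : A *ᵥ (fun k => (v k : ZMod (orderOf g))) = fun k => (w k : ZMod (orderOf g))) :
    expGcd g v ∣ expGcd g w := by
  obtain ⟨hv, hg⟩ := dvd_expGcd_iff.1 (dvd_refl (expGcd g v))
  refine dvd_expGcd_iff.2 ⟨fun k => ?_, hg⟩
  let f := ZMod.castHom hg (ZMod (expGcd g v))
  have hfv : (f ∘ fun k => (v k : ZMod (orderOf g))) = 0 := funext fun k => by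
    simpa [ZMod.intCast_zmod_eq_zero_iff_dvd] using hv k
  rw [← ZMod.intCast_zmod_eq_zero_iff_dvd, ← map_intCast f, ← congrFun h k, RingHom.map_mulVec,
    hfv, Matrix.mulVec_zero, Pi.zero_apply]

theorem mem_spOrbit_symm {R : Type*} [CommRing R] {z z' : Fin N ⊕ Fin N → R}
    (h : z' ∈ spOrbit z) : z ∈ spOrbit z' := by
  obtain ⟨A, rfl⟩ := h
  refine ⟨A⁻¹, ?_⟩
  rw [Matrix.mulVec_mulVec, ← Submonoid.coe_mul, inv_mul_cancel, Submonoid.coe_one,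
    Matrix.one_mulVec]

theorem expGcd_eq_of_mem_spOrbit
    (h : (fun k => (w k : ZMod (orderOf g))) ∈ spOrbit fun k => (v k : ZMod (orderOf g))) :
    expGcd g v = expGcd g w :=
  have dvd {v w : Fin N ⊕ Fin N → ℤ}
      (h : (fun k => (w k : ZMod (orderOf g))) ∈ spOrbit fun k => (v k : ZMod (orderOf g))) :
      expGcd g v ∣ expGcd g w := h.elim fun _ hA => expGcd_dvd_of_mulVec_eq hA
  Nat.dvd_antisymm (dvd h) (dvd (mem_spOrbit_symm h))

theorem intCast_homologyMatrix_mulVec_mem_spOrbit (R : Type*) [CommRing R] (φ : MapBdry N)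
    (v : Fin N ⊕ Fin N → ℤ) :
    (fun k => ((homologyMatrix φ *ᵥ v) k : R)) ∈ spOrbit fun k => (v k : R) :=
  ⟨⟨_, SymplecticGroup.map_mem (homologyMatrix_mem_symplecticGroup φ) (Int.castRingHom R)⟩,
    funext fun k => (RingHom.map_mulVec (Int.castRingHom R) _ v k).symm⟩

end GcdInvariance

section Reduction

variable {N : ℕ} {G : Type*} [Group G]

/-- Two exponent vectors are equivalent if a mapping class carries the tuple of powers of `g` with
the first exponents to the one with the second. -/
def powerSetoid (N : ℕ) (g : G) : Setoid (Fin N ⊕ Fin N → ℤ) where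
  r v w := ∃ φ : MapBdry N, actTuple φ.1 (powerTuple g v) = powerTuple g w
  iseqv :=
    { refl := fun _ => ⟨1, actTuple_one _⟩
      symm := by
        rintro v w ⟨φ, hφ⟩
        refine ⟨φ⁻¹, ?_⟩
        rw [← hφ, ← actTuple_mul, ← Subgroup.coe_mul, inv_mul_cancel]
        exact actTuple_one _
      trans := by
        rintro u v w ⟨φ, hφ⟩ ⟨ψ, hψ⟩
        exact ⟨ψ * φ, (actTuple_mul ψ.1 φ.1 _).trans (hφ ▸ hψ)⟩ }

theorem expGcd_eq_of_powerSetoid {g : G} {v w : Fin N ⊕ Fin N → ℤ} (h : powerSetoid N g v w) :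
    expGcd g v = expGcd g w := by
  obtain ⟨φ, hφ⟩ := h
  rw [actTuple_powerTuple, powerTuple_eq_iff] at hφ
  exact expGcd_eq_of_mem_spOrbit (hφ ▸ intCast_homologyMatrix_mulVec_mem_spOrbit _ φ v)

theorem powerSetoid_add_inr (g : G) (i : Fin N) (v : Fin N ⊕ Fin N → ℤ) :
    powerSetoid N g v (update v (Sum.inr i) (v (Sum.inr i) + v (Sum.inl i))) := by
  refine (powerSetoid N g).symm ?_
  obtain ⟨φ, hφ⟩ := exists_moveT (G := G) i
  refine ⟨φ, (hφ _).trans (funext fun l => ?_)⟩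
  obtain rfl | hl := eq_or_ne l i
  · simp [moveT, powerTuple, zpow_add, zpow_mul_comm g (v (Sum.inr l))]
  · simp [moveT, powerTuple, hl]

theorem powerSetoid_add_inl (g : G) (i : Fin N) (v : Fin N ⊕ Fin N → ℤ) :
    powerSetoid N g v (update v (Sum.inl i) (v (Sum.inl i) + v (Sum.inr i))) := by
  obtain ⟨φ, hφ⟩ := exists_moveU (G := G) i
  refine ⟨φ, (hφ _).trans (funext fun l => ?_)⟩
  obtain rfl | hl := eq_or_ne l i
  · simp [moveU, powerTuple, zpow_add, zpow_mul_comm g (v (Sum.inr l))]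
  · simp [moveU, powerTuple, hl]

theorem powerSetoid_rotate (g : G) (i : Fin N) (v : Fin N ⊕ Fin N → ℤ) :
    powerSetoid N g v
      (update (update v (Sum.inl i) (-v (Sum.inr i))) (Sum.inr i) (v (Sum.inl i))) := by
  obtain ⟨φ, hφ⟩ := exists_moveS (G := G) i
  refine ⟨φ, (hφ _).trans (funext fun l => ?_)⟩
  obtain rfl | hl := eq_or_ne l i
  · simp [moveS, powerTuple, mul_assoc, zpow_mul_comm g (v (Sum.inl l))]
  · simp [moveS, powerTuple, hl]

theorem powerSetoid_couple (g : G) {i j : Fin N} (hij : (j : ℕ) = i + 1)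
    (v : Fin N ⊕ Fin N → ℤ) :
    powerSetoid N g v (update (update v (Sum.inr i) (v (Sum.inr i) + v (Sum.inl j)))
      (Sum.inr j) (v (Sum.inr j) + v (Sum.inl i))) := by
  have hne : j ≠ i := by rintro rfl; omega
  obtain ⟨φ, hφ⟩ := exists_moveL (G := G) i j hij
  -- `moveL` adds across the two handles, but also subtracts within each of them.
  have hL : powerSetoid N g v (update (update v
      (Sum.inr i) (v (Sum.inr i) + v (Sum.inl j) - v (Sum.inl i)))
      (Sum.inr j) (v (Sum.inr j) + v (Sum.inl i) - v (Sum.inl j))) := by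
    refine ⟨φ, (hφ _).trans (funext fun l => ?_)⟩
    obtain rfl | hl := eq_or_ne l i
    · simp only [moveL, powerTuple, if_true, update_of_ne, update_self, hne.symm, ne_eq,
        reduceCtorEq, not_false_eq_true, Sum.inr.injEq, ← zpow_neg, ← zpow_add]
      exact congrArg _ (congrArg _ (by ring))
    obtain rfl | hlj := eq_or_ne l j
    · simp only [moveL, powerTuple, if_true, update_of_ne, update_self, hne, ne_eq,
        reduceCtorEq, not_false_eq_true, if_false, ← zpow_neg, ← zpow_add]
      exact congrArg₂ _ (congrArg _ (by ring)) (congrArg _ (by ring))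
    · simp [moveL, powerTuple, hl, hlj]
  have hi := powerSetoid_add_inr g i (update (update v
      (Sum.inr i) (v (Sum.inr i) + v (Sum.inl j) - v (Sum.inl i)))
      (Sum.inr j) (v (Sum.inr j) + v (Sum.inl i) - v (Sum.inl j)))
  refine (powerSetoid N g).trans hL ((powerSetoid N g).trans hi ?_)
  simpa [hne, hne.symm, update_comm] using powerSetoid_add_inr g j (update (update v
      (Sum.inr i) (v (Sum.inr i) + v (Sum.inl j)))
      (Sum.inr j) (v (Sum.inr j) + v (Sum.inl i) - v (Sum.inl j)))

theorem powerSetoid_elim_rotate (g : G) (j : Fin N) (m : Fin N → ℤ) :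
    powerSetoid N g (Sum.elim m 0) (Sum.elim (update m j 0) (update 0 j (m j))) := by
  simpa [-Sum.elim_update_left, -Sum.elim_update_right] using
    powerSetoid_rotate g j (Sum.elim m 0)

theorem powerSetoid_elim_add (g : G) {i j : Fin N} (hij : (j : ℕ) = i + 1 ∨ (i : ℕ) = j + 1)
    (m : Fin N → ℤ) :
    powerSetoid N g (Sum.elim m 0) (Sum.elim (update m j (m j + m i)) 0) := by
  have hne : i ≠ j := by rintro rfl; omega
  have hupd (x : ℤ) : update (update (0 : Fin N → ℤ) j x) i 0 = update (0 : Fin N → ℤ) j x :=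
    update_eq_self_iff.2 (update_of_ne hne x (0 : Fin N → ℤ)).symm
  have hadd : powerSetoid N g (Sum.elim (update m j 0) (update 0 j (m j)))
      (Sum.elim (update m j 0) (update 0 j (m j + m i))) := by
    rcases hij with h | h <;>
      simpa [-Sum.elim_update_left, -Sum.elim_update_right, hne, hupd] using
        powerSetoid_couple g h (Sum.elim (update m j 0) (update 0 j (m j)))
  have hback := powerSetoid_elim_rotate g j (update m j (m j + m i))
  rw [update_idem, update_self] at hback
  exact (powerSetoid N g).trans (powerSetoid_elim_rotate g j m)
    ((powerSetoid N g).trans hadd ((powerSetoid N g).symm hback))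

theorem exists_powerSetoid_elim (g : G) (v : Fin N ⊕ Fin N → ℤ) :
    ∃ m, powerSetoid N g v (Sum.elim m 0) := by
  suffices ∀ s : Finset (Fin N), ∃ w, powerSetoid N g v w ∧ ∀ i ∈ s, w (Sum.inr i) = 0 by
    obtain ⟨w, hw, hw₀⟩ := this Finset.univ
    have hinr : w ∘ Sum.inr = 0 := funext fun i => hw₀ i (Finset.mem_univ i)
    exact ⟨w ∘ Sum.inl, by rwa [← hinr, Sum.elim_comp_inl_inr]⟩
  intro s
  induction s using Finset.induction with
  | empty => exact ⟨v, (powerSetoid N g).refl v, by simp⟩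
  | insert i s _ ih =>
    obtain ⟨w, hw, hw₀⟩ := ih
    refine ⟨_, (powerSetoid N g).trans hw (rel_update_gcd Sum.inl_ne_inr
      (powerSetoid_add_inl g i) (powerSetoid_add_inr g i) w), fun k hk => ?_⟩
    obtain rfl | hki := eq_or_ne k i
    · rw [update_self]
    · rw [update_of_ne (by simpa), update_of_ne (by simp),
        hw₀ k (Finset.mem_of_mem_insert_of_ne hk hki)]

theorem powerSetoid_single_expGcd {n : ℕ} (g : G) (v : Fin (n + 1) ⊕ Fin (n + 1) → ℤ) :
    powerSetoid (n + 1) g v (Pi.single (Sum.inl 0) (expGcd g v : ℤ)) := by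
  obtain ⟨m, hm⟩ := exists_powerSetoid_elim g v
  obtain ⟨e, he⟩ := rel_single_of_adjacent_transvections
    (r := (powerSetoid (n + 1) g).comap fun m => Sum.elim m 0)
    (fun i m => powerSetoid_elim_add g (.inr <| by simp) m)
    (fun i m => powerSetoid_elim_add g (.inl <| by simp) m) m
  have hve : powerSetoid (n + 1) g v (Pi.single (Sum.inl 0) e) := by
    rw [← Sum.elim_single_zero]
    exact (powerSetoid (n + 1) g).trans hm he
  have hmod : powerSetoid (n + 1) g (Pi.single (Sum.inl 0) e)
      (update (Pi.single (Sum.inl 0) e) (Sum.inr 0) (orderOf g : ℤ)) := by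
    refine ⟨1, (actTuple_one _).trans (powerTuple_eq_iff.2 (funext fun k => ?_))⟩
    obtain rfl | hk := eq_or_ne k (Sum.inr 0) <;> simp [*]
  have hgcd := rel_update_gcd Sum.inl_ne_inr (powerSetoid_add_inl g (0 : Fin (n + 1)))
    (powerSetoid_add_inr g 0) (update (Pi.single (Sum.inl 0) e) (Sum.inr 0) (orderOf g : ℤ))
  refine (powerSetoid (n + 1) g).trans hve ((powerSetoid (n + 1) g).trans hmod ?_)
  rw [expGcd_eq_of_powerSetoid hve, expGcd_single]
  convert hgcd using 1
  simp [Pi.single, update_comm Sum.inl_ne_inr]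

theorem powerClass_mem_mapOrbit {g : G} {v w : Fin N ⊕ Fin N → ℤ}
    (h : expGcd g v = expGcd g w) : powerClass g w ∈ mapOrbit (powerClass g v) := by
  obtain ⟨φ, hφ⟩ : powerSetoid N g v w := by
    cases N with
    | zero => exact ⟨1, funext fun i => i.elim0⟩
    | succ n =>
      refine (powerSetoid _ g).trans (powerSetoid_single_expGcd g v) ?_
      exact h ▸ (powerSetoid _ g).symm (powerSetoid_single_expGcd g w)
  exact ⟨QuotientGroup.mk φ, Subtype.ext (congrArg classOf hφ)⟩

end Reduction

section OrbitsModOrder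

variable {N : ℕ} {G : Type*} [Group G] {g : G}

/-- The class of a tuple of powers of `g` as a function of the exponents modulo `orderOf g`; any
integer representatives may be chosen, and `ZMod.cast` is the choice made here. -/
noncomputable def powerClassMod (g : G) (z : Fin N ⊕ Fin N → ZMod (orderOf g)) : FlatClass N G :=
  powerClass g fun k => (z k).cast

theorem exists_intCast_eq {n : ℕ} (z : Fin N ⊕ Fin N → ZMod n) :
    ∃ v : Fin N ⊕ Fin N → ℤ, (fun k => (v k : ZMod n)) = z :=
  ZMod.intCast_surjective.comp_left z

theorem powerClassMod_intCast (g : G) (v : Fin N ⊕ Fin N → ℤ) :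
    powerClassMod g (fun k => (v k : ZMod (orderOf g))) = powerClass g v :=
  Subtype.ext <| congrArg classOf <| powerTuple_eq_iff.2 <| funext fun _ =>
    ZMod.intCast_zmod_cast _

theorem powerClassMod_injective
    (hg : ∀ x ∈ Subgroup.zpowers g, ∀ y ∈ Subgroup.zpowers g, IsConj x y → x = y) :
    Injective (powerClassMod (N := N) g) := by
  intro z z' h
  obtain ⟨v, rfl⟩ := exists_intCast_eq z
  obtain ⟨w, rfl⟩ := exists_intCast_eq z'
  rw [powerClassMod_intCast, powerClassMod_intCast, powerClass_eq_iff] at h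
  obtain ⟨c, hc⟩ := h
  have hpow k : g ^ w k = g ^ v k :=
    hg _ (Subgroup.zpow_mem_zpowers g _) _ (Subgroup.zpow_mem_zpowers g _)
      ⟨toUnits c, hc k⟩
  exact funext fun k => ((ZMod.intCast_eq_intCast_iff _ _ _).2
    (zpow_eq_zpow_iff_modEq.1 (hpow k))).symm

theorem mapOrbit_powerClassMod (g : G) (z : Fin N ⊕ Fin N → ZMod (orderOf g)) :
    mapOrbit (powerClassMod g z) = powerClassMod g '' spOrbit z := by
  obtain ⟨v, rfl⟩ := exists_intCast_eq z
  refine Set.Subset.antisymm ?_ ?_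
  · rintro _ ⟨φ, rfl⟩
    obtain ⟨φ, rfl⟩ := QuotientGroup.mk_surjective φ
    refine ⟨_, intCast_homologyMatrix_mulVec_mem_spOrbit _ φ v, ?_⟩
    rw [powerClassMod_intCast, powerClassMod_intCast, sigma_mk_powerClass]
  · rintro _ ⟨z', hz', rfl⟩
    obtain ⟨w, rfl⟩ := exists_intCast_eq z'
    rw [powerClassMod_intCast, powerClassMod_intCast]
    exact powerClass_mem_mapOrbit (expGcd_eq_of_mem_spOrbit hz')

theorem mem_mapOrbit_iff
    (hg : ∀ x ∈ Subgroup.zpowers g, ∀ y ∈ Subgroup.zpowers g, IsConj x y → x = y)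
    (v w : Fin N ⊕ Fin N → ℤ) :
    powerClass g w ∈ mapOrbit (powerClass g v) ↔ expGcd g v = expGcd g w := by
  refine ⟨fun h => expGcd_eq_of_mem_spOrbit ?_, powerClass_mem_mapOrbit⟩
  rwa [← powerClassMod_intCast, ← powerClassMod_intCast, mapOrbit_powerClassMod,
    (powerClassMod_injective hg).mem_set_image] at h

end OrbitsModOrder

end MCG

open MCG in
theorem theorem3p4_general {G : Type*} [Group G] (N : ℕ) (g : G) :
    (∀ v w : Fin N ⊕ Fin N → ℤ, expGcd g v = expGcd g w →
      powerClass g w ∈ mapOrbit (powerClass g v)) ∧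
    (∃ s : MapClosed N →* Matrix.symplecticGroup (Fin N) ℤ,
      (∀ φ : MapBdry N, (s (QuotientGroup.mk φ)).1 = homologyMatrix φ) ∧
      ∃ a : Matrix.symplecticGroup (Fin N) ℤ →* Equiv.Perm (powerClasses N g),
        (∀ (A : Matrix.symplecticGroup (Fin N) ℤ) (v : Fin N ⊕ Fin N → ℤ),
          a A ⟨powerClass g v, Set.mem_range_self v⟩ =
            ⟨powerClass g (A.1.mulVec v), Set.mem_range_self _⟩) ∧
        ∀ (φ : MapClosed N) (d : powerClasses N g), sigma N G φ d.1 = (a (s φ) d).1) ∧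
    ∃ P : (Fin N ⊕ Fin N → ZMod (orderOf g)) → FlatClass N G,
      (∀ v : Fin N ⊕ Fin N → ℤ, P (fun k => (v k : ZMod (orderOf g))) = powerClass g v) ∧
      (∀ z : Fin N ⊕ Fin N → ZMod (orderOf g), mapOrbit (P z) = P '' spOrbit z) ∧
      ((∀ x ∈ Subgroup.zpowers g, ∀ y ∈ Subgroup.zpowers g, IsConj x y → x = y) →
        Function.Injective P ∧ ∀ v w : Fin N ⊕ Fin N → ℤ,
          powerClass g w ∈ mapOrbit (powerClass g v) ↔ expGcd g v = expGcd g w) :=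
  ⟨fun _ _ => powerClass_mem_mapOrbit,
    ⟨symplecticRep N, fun _ => rfl, symplecticAct N g,
      fun A => matrixAct_powerClass g A.1, sigma_eq_symplecticAct g⟩,
    powerClassMod g, powerClassMod_intCast g, mapOrbit_powerClassMod g,
    fun hg => ⟨powerClassMod_injective hg, mem_mapOrbit_iff hg⟩⟩

open MCG in
theorem theorem3p4 {G : Type*} [Group G] [Finite G] (N : ℕ) (g : G) :
    -- (i) tuples with the same gcd lie in one orbit
    (∀ v w : Fin N ⊕ Fin N → ℤ, expGcd g v = expGcd g w →
      powerClass g w ∈ mapOrbit (powerClass g v)) ∧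
    -- (i) the action on classes of tuples of powers factors through `Sp(2N, ℤ)`
    (∃ s : MapClosed N →* Matrix.symplecticGroup (Fin N) ℤ,
      (∀ φ : MapBdry N, (s (QuotientGroup.mk φ)).1 = homologyMatrix φ) ∧
      ∃ a : Matrix.symplecticGroup (Fin N) ℤ →* Equiv.Perm (powerClasses N g),
        (∀ (A : Matrix.symplecticGroup (Fin N) ℤ) (v : Fin N ⊕ Fin N → ℤ),
          a A ⟨powerClass g v, Set.mem_range_self v⟩ =
            ⟨powerClass g (A.1.mulVec v), Set.mem_range_self _⟩) ∧
        ∀ (φ : MapClosed N) (d : powerClasses N g), sigma N G φ d.1 = (a (s φ) d).1) ∧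
    -- (ii)
    ((∀ x ∈ Subgroup.zpowers g, ∀ y ∈ Subgroup.zpowers g, IsConj x y → x = y) →
      (∀ v w : Fin N ⊕ Fin N → ℤ,
        powerClass g w ∈ mapOrbit (powerClass g v) ↔ expGcd g v = expGcd g w) ∧
      ∃ P : (Fin N ⊕ Fin N → ZMod (orderOf g)) → FlatClass N G,
        (∀ v : Fin N ⊕ Fin N → ℤ, P (fun k => (v k : ZMod (orderOf g))) = powerClass g v) ∧
        Function.Injective P ∧
        ∀ z : Fin N ⊕ Fin N → ZMod (orderOf g), mapOrbit (P z) = P '' spOrbit z) := by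
  obtain ⟨hγ, hs, P, hP, horb, hsep⟩ := theorem3p4_general N g
  exact ⟨hγ, hs, fun hg => ⟨(hsep hg).2, P, hP, (hsep hg).1, horb⟩⟩
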